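/- Let $k\ge 3$ and let $f:(\mathbb R^2,0)\to(\mathbb R^3,0)$ be a $C^\infty$ map-germ which is a normal form of a Whitney umbrella, i.e. $$f(u,v)=\Bigl(u,\;uv+\sum_{i=3}^k\frac{b_i}{i!}v^i+O(u,v)^{k+1},\;\sum_{j=2}^k\sum_{i=0}^j\frac{a_{i,j-i}}{i!\,(j-i)!}u^iv^{j-i}+O(u,v)^{k+1}\Bigr),\qquad a_{02}>0 .$$ For small $r>0$ let $\hat\gamma(\theta)=f(r\cos\theta,r\sin\theta)$, and let $\tilde{\mathbf n}(r,\theta)$ be the unit normal vector $(f_u\times f_v)/|f_u\times f_v|$ at $(r\cos\theta,r\sin\theta)$. A prime denotes the derivative with respect to $\theta$. Put $\mathcal A(\theta)=\sqrt{\cos^2\theta+(a_{11}\cos\theta+a_{02}\sin\theta)^2}$. * Write $\hat\gamma'=l\,\mathbf e$ with $l=|\hat\gamma'|$ and $\mathbf e$ a unit vector, and let $\hat\kappa_2=l\kappa_2$, where $\kappa_2=\mathbf e'\cdot\tilde{\mathbf n}$ is the coefficient of $\tilde{\mathbf n}$ in $\mathbf e'$ with respect to the orthonormal frame $\mathbf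 e,\ -\mathbf e\times\tilde{\mathbf n},\ \tilde{\mathbf n}$. Put $$F_{\hat\kappa_2}(\theta)=\cos\theta\bigl(a_{02}\cos^2\theta+(2a_{02}+a_{20})\sin^2\theta\bigr).$$ * Let $\beta(r,\theta)=-\dfrac{\hat\gamma'\cdot\tilde{\mathbf n}'}{\tilde{\mathbf n}'\cdot\tilde{\mathbf n}'}$, so that $\hat\gamma+\beta\,\tilde{\mathbf n}$ is the striction curve of the ruled surface $(\theta,t)\mapsto\hat\gamma(\theta)+t\,\tilde{\mathbf n}(\theta)$. A function $F(\theta)$, not identically zero, is called a first term of $x(r,\theta)$ if there are an integer $i\ge0$ and a nowhere vanishing function $x_0(\theta)$ such that, for every $\theta$, $x(r,\theta)=F(\theta)x_0(\theta)r^i+O(r^{i+1})$ as $r\to0$, $r>0$. **Theorem.** Uniformly in $\theta\in\mathbb R$, as $r\to 0$, $r>0$, $$\hat\kappa_2(r,\theta)=\frac{F_{\hat\kappa_2}(\theta)}{\mathcal A(\theta)}r^2+O(r^3),\qquad \beta(r,\theta)=\frac{\cos\theta\bigl(a_{02}\cos^2\theta+(2a_{02}+a_{20})\sin^2\theta\bigr)\mathcal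 A(\theta)^3}{a_{02}^2}\,r^2+O(r^3).$$ In particular $F_{\hat\kappa_2}$ is a first term of $\hat\kappa_2$, and $\beta$ has a first term. For every first term $F_\beta$ of $\beta$ and every $\theta\in\mathbb R$, $$F_{\hat\kappa_2}(\theta)=0\iff F_\beta(\theta)=0 .$$ -/

import Mathlib

open scoped ContDiff Topology RealInnerProductSpace

noncomputable section

namespace WhitneyUmbrella

/-- Euclidean 3-space. -/
abbrev E3 : Type := EuclideanSpace ℝ (Fin 3)

/-- The cross product of `ℝ³`, on Euclidean space. -/
def cross (x y : E3) : E3 := WithLp.toLp 2 (crossProduct x.ofLp y.ofLp)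

/-- `f` is (a representative of) a smooth map germ `(ℝ², 0) → ℝ³` of the form
`(u, uv + B(v) + O(u,v)^{k+1}, ∑_{j=2}^k A_j(u,v) + O(u,v)^{k+1})`, where
`B(v) = ∑_{i=3}^k b_i v^i / i!`, `A_j(u,v) = ∑_{i=0}^j a_{i,j-i} u^i v^{j-i} / (i! (j-i)!)`
and `a_{02} > 0`: the normal form of a Whitney umbrella. -/
structure IsNormalForm (k : ℕ) (a : ℕ → ℕ → ℝ) (b : ℕ → ℝ) (f : ℝ × ℝ → E3) : Prop where
  smooth : ∃ U ∈ 𝓝 (0 : ℝ × ℝ), ContDiffOn ℝ ∞ f U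
  fst_eq : ∀ᶠ p in 𝓝 (0 : ℝ × ℝ), f p 0 = p.1
  snd_eq : (fun p : ℝ × ℝ =>
      f p 1 - (p.1 * p.2 + ∑ i ∈ Finset.Icc 3 k, b i / (i.factorial : ℝ) * p.2 ^ i))
        =O[𝓝 0] fun p => ‖p‖ ^ (k + 1)
  thd_eq : (fun p : ℝ × ℝ =>
      f p 2 - ∑ j ∈ Finset.Icc 2 k, ∑ i ∈ Finset.range (j + 1),
        a i (j - i) / ((i.factorial : ℝ) * ((j - i).factorial : ℝ)) * p.1 ^ i * p.2 ^ (j - i))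
        =O[𝓝 0] fun p => ‖p‖ ^ (k + 1)
  a02_pos : 0 < a 0 2

/-- The normal vector `f_u × f_v`. -/
def normal (f : ℝ × ℝ → E3) (p : ℝ × ℝ) : E3 :=
  cross (fderiv ℝ f p (1, 0)) (fderiv ℝ f p (0, 1))

/-- The unit normal vector `(f_u × f_v) / |f_u × f_v|` of `f` (at regular points). -/
def unitNormal (f : ℝ × ℝ → E3) (p : ℝ × ℝ) : E3 := ‖normal f p‖⁻¹ • normal f p

/-- Polar coordinates `(r, θ) ↦ (r cos θ, r sin θ)`; for fixed `r` this is the circle `γ`. -/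
def polar (r θ : ℝ) : ℝ × ℝ := (r * Real.cos θ, r * Real.sin θ)

/-- The curve `γ̂ = f ∘ γ` which goes around the umbrella. -/
def curve (f : ℝ × ℝ → E3) (r θ : ℝ) : E3 := f (polar r θ)

/-- The unit normal vector of `f` along the curve. -/
def normalAlong (f : ℝ × ℝ → E3) (r θ : ℝ) : E3 := unitNormal f (polar r θ)

/-- For a ruled surface `(t, β) ↦ γ(t) + β δ(t)`, the coefficient `β(t)` for which
`σ(t) = γ(t) + β(t) δ(t)` is the striction curve: `β = -(γ'⬝δ') / (δ'⬝δ')`. -/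
def strictionCoeff (γ δ : ℝ → E3) (t : ℝ) : ℝ :=
  -(⟪deriv γ t, deriv δ t⟫ / ⟪deriv δ t, deriv δ t⟫)

/-- The function `β(r, θ)`: the striction curve of the ruled surface generated by the unit normal
vector along the curve `γ̂` is `γ̂ + β ñ`. -/
def beta (f : ℝ × ℝ → E3) (r θ : ℝ) : ℝ := strictionCoeff (curve f r) (normalAlong f r) θ

/-- The function `l` in `γ' = l e`, with `e` a unit vector field along `γ`. -/
def speed (γ : ℝ → E3) (t : ℝ) : ℝ := ‖deriv γ t‖

/-- The unit vector field `e` in `γ' = l e`. -/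
def tangent (γ : ℝ → E3) (t : ℝ) : E3 := (speed γ t)⁻¹ • deriv γ t

/-- `κ₂` in the Frenet type formula `e' = κ₁ b + κ₂ n`, `b' = -κ₁ e + κ₃ n`, `n' = -κ₂ e - κ₃ b`
of the orthonormal frame `e, b = -e × n, n` along `γ`. -/
def kappa2 (γ n : ℝ → E3) (t : ℝ) : ℝ := ⟪deriv (tangent γ) t, n t⟫

/-- `κ̂₂ = l κ₂` for the frame given by the unit normal vector of `f` along the curve `γ̂`. -/
def kappaHat2 (f : ℝ × ℝ → E3) (r θ : ℝ) : ℝ :=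
  speed (curve f r) θ * kappa2 (curve f r) (normalAlong f r) θ

/-- `𝒜(θ) = √(cos² θ + (a₁₁ cos θ + a₀₂ sin θ)²)`. -/
def calA (a : ℕ → ℕ → ℝ) (θ : ℝ) : ℝ :=
  Real.sqrt (Real.cos θ ^ 2 + (a 1 1 * Real.cos θ + a 0 2 * Real.sin θ) ^ 2)

/-- `F_{κ̂₂}(θ) = cos θ (a₀₂ cos² θ + (2 a₀₂ + a₂₀) sin² θ)`. -/
def FkappaHat2 (a : ℕ → ℕ → ℝ) (θ : ℝ) : ℝ :=
  Real.cos θ * (a 0 2 * Real.cos θ ^ 2 + (2 * a 0 2 + a 2 0) * Real.sin θ ^ 2)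

/-- `F` is a first term of `x(r, θ)` as `r → 0`, `r > 0`: there are an exponent `i` and a nowhere
vanishing function `x₀` such that `x(r, θ) = F(θ) x₀(θ) r^i + O(r^{i+1})` for every `θ`.
That `F` is not the zero function makes `i` the leading exponent (the zero function would
otherwise be a first term of every function of higher order). The choice of `x₀` changes `F`
by a nowhere vanishing factor only. -/
def IsFirstTerm (x : ℝ → ℝ → ℝ) (F : ℝ → ℝ) : Prop :=
  F ≠ 0 ∧ ∃ (i : ℕ) (x₀ : ℝ → ℝ), (∀ θ, x₀ θ ≠ 0) ∧
    ∀ θ, (fun r : ℝ => x r θ - F θ * x₀ θ * r ^ i) =O[𝓝[>] 0] fun r => r ^ (i + 1)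

/-- `x(r, θ) = c(θ) r^i + O(r^{i+1})` as `r → 0`, `r > 0`, uniformly in `θ`. -/
def HasLeadingTerm (x : ℝ → ℝ → ℝ) (c : ℝ → ℝ) (i : ℕ) : Prop :=
  ∃ C r₀ : ℝ, 0 < r₀ ∧ ∀ r θ : ℝ, 0 < r → r < r₀ → |x r θ - c θ * r ^ i| ≤ C * r ^ (i + 1)

end WhitneyUmbrella

end

/-!
The unit normal `ñ` is orthogonal to `γ̂'`, hence `κ̂₂ = ⟪γ̂'', ñ⟫`. Along the circle `p(θ)` of
radius `r` one has `γ̂'' = D²f(p)(p', p') + Df(p) p''`, and the second summand is tangent to the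
surface, so `κ̂₂ = ⟪D²f(p)(p', p'), N⟫ / |N|` with `N = f_u × f_v`. Differentiating `⟪γ̂', ñ⟫ = 0`
gives `⟪γ̂', ñ'⟫ = -κ̂₂`, whence `β = κ̂₂ / |ñ'|²`, where `|ñ'| = |N × N'| / |N|²`.

At the umbrella point `N` vanishes, but its differential is injective because `a₀₂ ≠ 0`. Thus
`N / r` stays bounded away from `0`, and `κ̂₂ / r²` and `β / r²` converge uniformly in `θ`, with an
error `O(r)`, to the expressions obtained by replacing `D²f(p)`, `N / r` and `DN(p)` by `D²f(0)`,
`DN(0)(cos θ, sin θ)` and `DN(0)`. These depend only on the 2-jet of `f`.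
-/

noncomputable section

open Filter Asymptotics

namespace WhitneyUmbrella

lemma isBigO_pow_pow_of_le {ι : Type*} {l : Filter ι} {u : ι → ℝ} (hu : Tendsto u l (𝓝 0))
    {m n : ℕ} (hmn : m ≤ n) : (fun i => u i ^ n) =O[l] fun i => u i ^ m := by
  simpa only [one_pow, mul_one, pow_mul_pow_sub _ hmn] using
    (isBigO_refl (fun i => u i ^ m) l).mul ((hu.isBigO_one ℝ).pow (n - m))

lemma isBigO_monomial (c : ℝ) {i j n : ℕ} (hn : n ≤ i + j) :
    (fun p : ℝ × ℝ => c * p.1 ^ i * p.2 ^ j) =O[𝓝 0] fun p => ‖p‖ ^ n := by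
  have hmonomial : (fun p : ℝ × ℝ => c * p.1 ^ i * p.2 ^ j) =O[𝓝 0] fun p => ‖p‖ ^ (i + j) := by
    simpa only [pow_add] using ((isBigO_fst_prod'.norm_right.pow i).const_mul_left c).mul
      (isBigO_snd_prod'.norm_right.pow j)
  exact hmonomial.trans (isBigO_pow_pow_of_le tendsto_norm_zero hn)

lemma isBigO_euclideanSpace {ι α : Type*} [Fintype ι] {l : Filter α} {u : α → EuclideanSpace ℝ ι}
    {g : α → ℝ} (hu : ∀ i, (fun x => u x i) =O[l] g) : u =O[l] g :=
  ((EuclideanSpace.equiv ι ℝ).symm.isBigO_comp (fun x => (u x).ofLp) l).trans (isBigO_pi.2 hu)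

section Taylor

variable {E F : Type*} [NormedAddCommGroup E] [NormedSpace ℝ E]
  [NormedAddCommGroup F] [NormedSpace ℝ F] {f : E → F} {x : E}

lemma isBigO_sub_pow_succ_of_fderiv {n : ℕ} (hd : ∀ᶠ y in 𝓝 x, DifferentiableAt ℝ f y)
    (hf : fderiv ℝ f =O[𝓝 x] fun y => ‖y - x‖ ^ n) :
    (fun y => f y - f x) =O[𝓝 x] fun y => ‖y - x‖ ^ (n + 1) := by
  obtain ⟨C, hC0, hC⟩ := hf.exists_nonneg
  obtain ⟨ε, hε, hball⟩ := Metric.eventually_nhds_iff_ball.1 (hd.and hC.bound)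
  refine IsBigO.of_bound C ?_
  filter_upwards [Metric.ball_mem_nhds x hε] with y hy
  have hsub : Metric.closedBall x ‖y - x‖ ⊆ Metric.ball x ε :=
    Metric.closedBall_subset_ball (by rwa [← dist_eq_norm])
  have hderiv : ∀ z ∈ Metric.closedBall x ‖y - x‖, ‖fderiv ℝ f z‖ ≤ C * ‖y - x‖ ^ n := by
    intro z hz
    refine (hball z (hsub hz)).2.trans ?_
    rw [norm_pow, norm_norm]
    gcongr
    exact mem_closedBall_iff_norm.1 hz
  have hmvt := (convex_closedBall x ‖y - x‖).norm_image_sub_le_of_norm_fderiv_le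
    (fun z hz => (hball z (hsub hz)).1) hderiv
    (Metric.mem_closedBall_self (norm_nonneg _)) (mem_closedBall_iff_norm.2 le_rfl)
  simpa only [norm_pow, norm_norm, norm_mul, pow_succ, mul_assoc] using hmvt

lemma eventually_differentiableAt (hf : ContDiffAt ℝ 1 f x) :
    ∀ᶠ y in 𝓝 x, DifferentiableAt ℝ f y :=
  (hf.eventually (by simp)).mono fun _ hy => hy.differentiableAt one_ne_zero

lemma isBigO_sub_sub_fderiv (hf : ContDiffAt ℝ 2 f x) :
    (fun y => f y - f x - fderiv ℝ f x (y - x)) =O[𝓝 x] fun y => ‖y - x‖ ^ 2 := by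
  have hd := eventually_differentiableAt (hf.of_le one_le_two)
  have hlin : ∀ y, HasFDerivAt (fun y => fderiv ℝ f x (y - x)) (fderiv ℝ f x) y := fun y =>
    (fderiv ℝ f x).hasFDerivAt.comp y ((hasFDerivAt_id y).sub_const x)
  have hf' : DifferentiableAt ℝ (fderiv ℝ f) x :=
    (hf.fderiv_right (m := 1) (by norm_num)).differentiableAt one_ne_zero
  have hrem : (fun y => fderiv ℝ f y - fderiv ℝ f x) =O[𝓝 x] fun y => ‖y - x‖ ^ 1 := by
    simpa only [pow_one] using hf'.hasFDerivAt.isBigO_sub.norm_right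
  have hjet : ∀ᶠ y in 𝓝 x, HasFDerivAt (fun y => f y - fderiv ℝ f x (y - x))
      (fderiv ℝ f y - fderiv ℝ f x) y := hd.mono fun y hy => hy.hasFDerivAt.sub (hlin y)
  have hbound := isBigO_sub_pow_succ_of_fderiv (n := 1) (hjet.mono fun y hy => hy.differentiableAt)
    (hrem.congr' (hjet.mono fun y hy => hy.fderiv.symm) EventuallyEq.rfl)
  refine hbound.congr_left fun y => ?_
  rw [sub_self, map_zero, sub_zero, sub_right_comm]

lemma hasFDerivAt_half_bilinear_self {B : E →L[ℝ] E →L[ℝ] F} (hB : ∀ v w, B v w = B w v)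
    (y : E) :
    HasFDerivAt (fun y => (1 / 2 : ℝ) • B (y - x) (y - x)) (B (y - x)) y := by
  have hsub := (hasFDerivAt_id (𝕜 := ℝ) y).sub_const x
  refine ((B.hasFDerivAt_of_bilinear hsub hsub).const_smul (1 / 2 : ℝ)).congr_fderiv ?_
  ext v
  simp [hB v, ← two_smul ℝ]

lemma isBigO_sub_sub_fderiv_sub_fderiv_fderiv (hf : ContDiffAt ℝ 3 f x) :
    (fun y => f y - f x - fderiv ℝ f x (y - x)
      - (1 / 2 : ℝ) • fderiv ℝ (fderiv ℝ f) x (y - x) (y - x)) =O[𝓝 x] fun y => ‖y - x‖ ^ 3 := by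
  set B := fderiv ℝ (fderiv ℝ f) x
  have hB : ∀ v w, B v w = B w v := hf.isSymmSndFDerivAt (by simp; norm_num)
  have hd := eventually_differentiableAt (hf.of_le (by norm_num))
  have hlin : ∀ y, HasFDerivAt (fun y => fderiv ℝ f x (y - x)) (fderiv ℝ f x) y := fun y =>
    (fderiv ℝ f x).hasFDerivAt.comp y ((hasFDerivAt_id y).sub_const x)
  have hjet : ∀ᶠ y in 𝓝 x, HasFDerivAt (fun y => f y - fderiv ℝ f x (y - x)
      - (1 / 2 : ℝ) • B (y - x) (y - x)) (fderiv ℝ f y - fderiv ℝ f x - B (y - x)) y :=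
    hd.mono fun y hy => (hy.hasFDerivAt.sub (hlin y)).sub (hasFDerivAt_half_bilinear_self hB y)
  have hbound := isBigO_sub_pow_succ_of_fderiv (n := 2) (hjet.mono fun y hy => hy.differentiableAt)
    ((isBigO_sub_sub_fderiv (hf.fderiv_right (m := 2) (by norm_num))).congr'
      (hjet.mono fun y hy => hy.fderiv.symm) EventuallyEq.rfl)
  refine hbound.congr_left fun y => ?_
  simp only [sub_self, map_zero, smul_zero, sub_zero]
  abel

lemma bilinear_eq_zero_of_isBigO {B : E →L[ℝ] E →L[ℝ] F} (hB : ∀ v w, B v w = B w v)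
    (h : (fun y => B y y) =O[𝓝 0] fun y => ‖y‖ ^ 3) : B = 0 := by
  let p : E [×2]→L[ℝ] F := B.uncurryBilinear.compContinuousLinearMap
    fun _ => (ContinuousLinearMap.id ℝ E).prod (ContinuousLinearMap.id ℝ E)
  have hdiag : ∀ v, B v v = 0 := IsBigO.continuousMultilinearMap_apply_eq_zero (p := p) h
  ext v w
  have hpolar := hdiag (v + w)
  simp only [map_add, add_apply, hdiag, zero_add, add_zero, hB w v, ← two_smul ℝ] at hpolar
  simpa using hpolar

lemma eq_taylor_coeffs_of_isBigO (hf : ContDiffAt ℝ 3 f x) {c : F} {ℓ : E →L[ℝ] F}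
    {B : E →L[ℝ] E →L[ℝ] F} (hB : ∀ v w, B v w = B w v)
    (h : (fun y => f y - (c + ℓ (y - x) + (1 / 2 : ℝ) • B (y - x) (y - x)))
      =O[𝓝 x] fun y => ‖y - x‖ ^ 3) :
    f x = c ∧ fderiv ℝ f x = ℓ ∧ fderiv ℝ (fderiv ℝ f) x = B := by
  have hc : f x = c := by simpa [sub_eq_zero] using h.eq_zero_of_norm_pow three_ne_zero
  have hℓ : fderiv ℝ f x = ℓ := by
    have hjet : HasFDerivAt (fun y => c + ℓ (y - x) + (1 / 2 : ℝ) • B (y - x) (y - x))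
        (ℓ + B (x - x)) x :=
      ((ℓ.hasFDerivAt.comp x ((hasFDerivAt_id x).sub_const x)).const_add c).add
        (hasFDerivAt_half_bilinear_self hB x)
    have hsum := (h.hasFDerivAt (𝕜 := ℝ) (by norm_num)).fun_add hjet
    simp only [sub_add_cancel] at hsum
    simpa using hsum.fderiv
  refine ⟨hc, hℓ, sub_eq_zero.1 (bilinear_eq_zero_of_isBigO (fun v w => ?_) ?_)⟩
  · have hsymm := hf.isSymmSndFDerivAt (by simp; norm_num) v w
    simp only [sub_apply, hB v w, hsymm]
  have hdiff := (h.sub (isBigO_sub_sub_fderiv_sub_fderiv_fderiv hf)).const_smul_left (2 : ℝ)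
  have hshift : Tendsto (fun y => y + x) (𝓝 0) (𝓝 x) :=
    (continuous_add_const x).tendsto' 0 x (zero_add x)
  refine (hdiff.comp_tendsto hshift).congr (fun y => ?_) fun y => ?_
  · simp only [Function.comp_apply, Pi.smul_apply, add_sub_cancel_right, hc, hℓ, sub_apply]
    module
  · simp only [Function.comp_apply, add_sub_cancel_right]

end Taylor

section BoundedApprox

lemma eventually_ne_zero_of_one_isBigO {ι : Type*} {l : Filter ι} {u : ι → ℝ}
    (hu : (fun _ => (1 : ℝ)) =O[l] u) : ∀ᶠ i in l, u i ≠ 0 :=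
  hu.eq_zero_imp.mono fun _ hi h0 => one_ne_zero (hi h0)

variable {ι : Type*} {E F G : Type*} [NormedAddCommGroup E] [NormedAddCommGroup F]
  [NormedAddCommGroup G]

/-- `x` is approximated along `l`, to the order of the gauge `g`, by the bounded family `c`.
With `ι = ℝ × ℝ` and `l` a product with `⊤`, this is approximation uniform in the second variable;
boundedness is what makes the notion stable under products. -/
structure IsBoundedApprox (l : Filter ι) (g : ι → ℝ) (x c : ι → E) : Prop where
  isBigO_one : c =O[l] fun _ => (1 : ℝ)
  isBigO_sub : (fun i => x i - c i) =O[l] g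

namespace IsBoundedApprox

variable {l : Filter ι} {g : ι → ℝ}

lemma refl {c : ι → E} (hc : c =O[l] fun _ => (1 : ℝ)) : IsBoundedApprox l g c c :=
  ⟨hc, by simpa only [sub_self] using isBigO_zero g l⟩

lemma congr {x y c d : ι → E} (h : IsBoundedApprox l g x c) (hxy : x =ᶠ[l] y)
    (hcd : ∀ i, c i = d i) : IsBoundedApprox l g y d := by
  obtain rfl : c = d := funext hcd
  exact ⟨h.isBigO_one, h.isBigO_sub.congr' (hxy.sub EventuallyEq.rfl) EventuallyEq.rfl⟩

lemma isBigO_one_left {x c : ι → E} (h : IsBoundedApprox l g x c) (hg : Tendsto g l (𝓝 0)) :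
    x =O[l] fun _ => (1 : ℝ) := by
  simpa only [sub_add_cancel] using (h.isBigO_sub.trans (hg.isBigO_one ℝ)).add h.isBigO_one

lemma bilinear [NormedSpace ℝ E] [NormedSpace ℝ F] [NormedSpace ℝ G] {x c : ι → E} {y d : ι → F}
    (hx : IsBoundedApprox l g x c) (hy : IsBoundedApprox l g y d) (hg : Tendsto g l (𝓝 0))
    (B : E →L[ℝ] F →L[ℝ] G) :
    IsBoundedApprox l g (fun i => B (x i) (y i)) fun i => B (c i) (d i) where
  isBigO_one := by
    simpa only [mul_one] using
      B.isBoundedBilinearMap.isBigO_comp.trans (hx.isBigO_one.norm_left.mul hy.isBigO_one.norm_left)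
  isBigO_sub := by
    have hbound : ∀ {u : ι → E} {v : ι → F},
        (fun i => B (u i) (v i)) =O[l] fun i => ‖u i‖ * ‖v i‖ :=
      B.isBoundedBilinearMap.isBigO_comp
    have hleft := hbound.trans (hx.isBigO_sub.norm_left.mul (hy.isBigO_one_left hg).norm_left)
    have hright := hbound.trans (hx.isBigO_one.norm_left.mul hy.isBigO_sub.norm_left)
    simp only [mul_one, one_mul] at hleft hright
    refine (hleft.add hright).congr_left fun i => ?_
    simp only [map_sub, sub_apply]
    abel

lemma norm {x c : ι → E} (h : IsBoundedApprox l g x c) :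
    IsBoundedApprox l g (fun i => ‖x i‖) fun i => ‖c i‖ where
  isBigO_one := h.isBigO_one.norm_left
  isBigO_sub := (IsBigO.of_norm_le fun i => abs_norm_sub_norm_le (x i) (c i)).trans
    h.isBigO_sub.norm_left

lemma mul {x y c d : ι → ℝ} (hx : IsBoundedApprox l g x c) (hy : IsBoundedApprox l g y d)
    (hg : Tendsto g l (𝓝 0)) : IsBoundedApprox l g (fun i => x i * y i) fun i => c i * d i :=
  hx.bilinear hy hg (ContinuousLinearMap.mul ℝ ℝ)

lemma one_isBigO_left {x c : ι → ℝ} (h : IsBoundedApprox l g x c) (hg : Tendsto g l (𝓝 0))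
    (hc : (fun _ => (1 : ℝ)) =O[l] c) : (fun _ => (1 : ℝ)) =O[l] x := by
  have hequiv : IsEquivalent l x c :=
    (h.isBigO_sub.trans_isLittleO ((isLittleO_one_iff ℝ).2 hg)).trans_isBigO hc
  exact hc.trans hequiv.isBigO_symm

lemma inv {x c : ι → ℝ} (h : IsBoundedApprox l g x c) (hg : Tendsto g l (𝓝 0))
    (hc : (fun _ => (1 : ℝ)) =O[l] c) :
    IsBoundedApprox l g (fun i => (x i)⁻¹) fun i => (c i)⁻¹ := by
  have hinv : ∀ {y : ι → ℝ}, (fun _ => (1 : ℝ)) =O[l] y →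
      (fun i => (y i)⁻¹) =O[l] fun _ => (1 : ℝ) :=
    fun hy => by simpa only [inv_one] using hy.inv_rev (by simp)
  have hx := h.one_isBigO_left hg hc
  refine ⟨hinv hc, ?_⟩
  have hprod := (h.isBigO_sub.neg_left.mul (hinv hx)).mul (hinv hc)
  simp only [mul_one] at hprod
  refine hprod.congr' ?_ EventuallyEq.rfl
  filter_upwards [eventually_ne_zero_of_one_isBigO hx, eventually_ne_zero_of_one_isBigO hc]
    with i hxi hci
  field_simp
  ring

end IsBoundedApprox

end BoundedApprox

section Polar

variable {E : Type*} [NormedAddCommGroup E]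

/-- The filter on pairs `(r, θ)` for limits as `r → 0`, `r > 0`, uniformly in `θ`. -/
def polarFilter : Filter (ℝ × ℝ) := 𝓝[>] 0 ×ˢ ⊤

lemma eventually_polarFilter {P : ℝ × ℝ → Prop} :
    (∀ᶠ q in polarFilter, P q) ↔ ∀ᶠ r in 𝓝[>] (0 : ℝ), ∀ θ, P (r, θ) := by
  rw [polarFilter, ← principal_univ, eventually_prod_principal_iff]
  simp

lemma eventually_fst_pos : ∀ᶠ q in polarFilter, 0 < q.1 :=
  eventually_polarFilter.2 (eventually_mem_nhdsWithin.mono fun _ hr _ => hr)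

lemma tendsto_fst_polarFilter : Tendsto Prod.fst polarFilter (𝓝 (0 : ℝ)) :=
  tendsto_fst.mono_right nhdsWithin_le_nhds

lemma isBigO_one_polarFilter {u : ℝ → E} {C : ℝ} (hu : ∀ θ, ‖u θ‖ ≤ C) :
    (fun q : ℝ × ℝ => u q.2) =O[polarFilter] fun _ => (1 : ℝ) :=
  IsBigO.of_bound C (Eventually.of_forall fun q => by simpa using hu q.2)

variable [NormedSpace ℝ E]

lemma polar_eq_smul (r θ : ℝ) : polar r θ = r • polar 1 θ := by
  simp [polar]

lemma norm_polar_one_le (θ : ℝ) : ‖polar 1 θ‖ ≤ 1 := by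
  simpa [polar, Prod.norm_def] using ⟨Real.abs_cos_le_one θ, Real.abs_sin_le_one θ⟩

lemma isBigO_polar : (fun q : ℝ × ℝ => polar q.1 q.2) =O[polarFilter] Prod.fst :=
  IsBigO.of_bound' (Eventually.of_forall fun q => by
    rw [polar_eq_smul, norm_smul]
    exact mul_le_of_le_one_right (norm_nonneg _) (norm_polar_one_le _))

lemma tendsto_polar : Tendsto (fun q : ℝ × ℝ => polar q.1 q.2) polarFilter (𝓝 0) :=
  isBigO_polar.trans_tendsto tendsto_fst_polarFilter

lemma hasDerivAt_polar (r θ : ℝ) : HasDerivAt (polar r) (polar r (θ + Real.pi / 2)) θ := by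
  rw [polar, Real.cos_add_pi_div_two, Real.sin_add_pi_div_two]
  exact ((Real.hasDerivAt_cos θ).const_mul r).prodMk ((Real.hasDerivAt_sin θ).const_mul r)

lemma polar_add_pi_div_two_add_pi_div_two (r θ : ℝ) :
    polar r (θ + Real.pi / 2 + Real.pi / 2) = -polar r θ := by
  simp [polar, Real.cos_add_pi_div_two, Real.sin_add_pi_div_two]

lemma isBoundedApprox_comp_polar {G : ℝ × ℝ → E} (hG : DifferentiableAt ℝ G 0) :
    IsBoundedApprox polarFilter Prod.fst (fun q => G (polar q.1 q.2)) fun _ => G 0 where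
  isBigO_one := isBigO_const_const _ one_ne_zero _
  isBigO_sub := by
    have hlipschitz := hG.hasFDerivAt.isBigO_sub.comp_tendsto tendsto_polar
    simp only [Function.comp_def, sub_zero] at hlipschitz
    exact hlipschitz.trans isBigO_polar

lemma isBoundedApprox_inv_smul_comp_polar {G : ℝ × ℝ → E} (hG : ContDiffAt ℝ 2 G 0)
    (h0 : G 0 = 0) :
    IsBoundedApprox polarFilter Prod.fst (fun q => q.1⁻¹ • G (polar q.1 q.2))
      fun q => fderiv ℝ G 0 (polar 1 q.2) where
  isBigO_one := isBigO_one_polarFilter fun θ =>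
    (fderiv ℝ G 0).le_of_opNorm_le_of_le le_rfl (norm_polar_one_le θ)
  isBigO_sub := by
    have htaylor := (isBigO_sub_sub_fderiv hG).comp_tendsto tendsto_polar
    simp only [Function.comp_def, sub_zero, h0] at htaylor
    have hsq := (isBigO_refl (fun q : ℝ × ℝ => q.1⁻¹) polarFilter).smul
      (htaylor.trans (isBigO_polar.norm_left.pow 2))
    refine hsq.congr' ?_ ?_
    · filter_upwards [eventually_fst_pos] with q hq
      rw [polar_eq_smul q.1 q.2, map_smul, smul_sub, inv_smul_smul₀ hq.ne']
    · filter_upwards [eventually_fst_pos] with q hq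
      rw [smul_eq_mul, pow_two, inv_mul_cancel_left₀ hq.ne']

end Polar

section LeadingTerm

variable {x : ℝ → ℝ → ℝ} {c F G : ℝ → ℝ} {n : ℕ}

lemma hasLeadingTerm_of_isBoundedApprox
    (h : IsBoundedApprox polarFilter Prod.fst (fun q => x q.1 q.2 / q.1 ^ n) fun q => c q.2) :
    HasLeadingTerm x c n := by
  obtain ⟨C, hC⟩ := h.isBigO_sub.bound
  obtain ⟨r₀, hr₀, hbound⟩ := mem_nhdsGT_iff_exists_Ioo_subset.1 (eventually_polarFilter.1 hC)
  refine ⟨C, r₀, hr₀, fun r θ hr hrr₀ => ?_⟩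
  have hle : |x r θ / r ^ n - c θ| ≤ C * r := by
    simpa [abs_of_pos hr] using hbound ⟨hr, hrr₀⟩ θ
  calc |x r θ - c θ * r ^ n| = |x r θ / r ^ n - c θ| * r ^ n := by
        rw [← abs_of_pos (pow_pos hr n), ← abs_mul, sub_mul, abs_of_pos (pow_pos hr n),
          div_mul_cancel₀ _ (pow_pos hr n).ne']
    _ ≤ C * r * r ^ n := by gcongr
    _ = C * r ^ (n + 1) := by ring

lemma HasLeadingTerm.isBigO (h : HasLeadingTerm x c n) (θ : ℝ) :
    (fun r => x r θ - c θ * r ^ n) =O[𝓝[>] 0] fun r => r ^ (n + 1) := by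
  obtain ⟨C, r₀, hr₀, hC⟩ := h
  refine IsBigO.of_bound C ?_
  filter_upwards [Ioo_mem_nhdsGT hr₀] with r hr
  rw [Real.norm_eq_abs, Real.norm_of_nonneg (pow_nonneg hr.1.le _)]
  exact hC r θ hr.1 hr.2

lemma HasLeadingTerm.isFirstTerm {x₀ : ℝ → ℝ} (h : HasLeadingTerm x (fun θ => F θ * x₀ θ) n)
    (hF : F ≠ 0) (hx₀ : ∀ θ, x₀ θ ≠ 0) : IsFirstTerm x F :=
  ⟨hF, n, x₀, hx₀, h.isBigO⟩

lemma eq_zero_of_mul_pow_isBigO {b : ℝ} {m n : ℕ} (hmn : m < n)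
    (h : (fun r => b * r ^ m) =O[𝓝[>] (0 : ℝ)] fun r => r ^ n) : b = 0 := by
  by_contra hb
  have hlittle : (fun r : ℝ => r ^ m) =o[𝓝[>] 0] fun r => r ^ m :=
    ((isBigO_const_mul_left_iff hb).1 h).trans_isLittleO
      ((isLittleO_pow_pow hmn).mono nhdsWithin_le_nhds)
  refine isLittleO_irrefl (Eventually.frequently ?_) hlittle
  filter_upwards [self_mem_nhdsWithin] with r hr using (pow_pos hr m).ne'

lemma exponent_le_of_isBigO {y : ℝ → ℝ} {b d : ℝ} {m n : ℕ} (hb : b ≠ 0)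
    (hm : (fun r => y r - b * r ^ m) =O[𝓝[>] (0 : ℝ)] fun r => r ^ (m + 1))
    (hn : (fun r => y r - d * r ^ n) =O[𝓝[>] (0 : ℝ)] fun r => r ^ (n + 1)) : n ≤ m := by
  by_contra! hmn
  have hpow : ∀ {j}, m < j → (fun r : ℝ => r ^ j) =O[𝓝[>] 0] fun r => r ^ (m + 1) :=
    isBigO_pow_pow_of_le (tendsto_id.mono_left nhdsWithin_le_nhds)
  have hy : y =O[𝓝[>] 0] fun r => r ^ (m + 1) := by
    simpa only [sub_add_cancel] using
      (hn.trans (hpow (hmn.trans n.lt_succ_self))).add ((hpow hmn).const_mul_left d)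
  exact hb (eq_zero_of_mul_pow_isBigO m.lt_succ_self
    (by simpa only [sub_sub_cancel] using hy.sub hm))

lemma coeff_eq_of_isBigO {y : ℝ → ℝ} {b d : ℝ} {n : ℕ}
    (hb : (fun r => y r - b * r ^ n) =O[𝓝[>] (0 : ℝ)] fun r => r ^ (n + 1))
    (hd : (fun r => y r - d * r ^ n) =O[𝓝[>] (0 : ℝ)] fun r => r ^ (n + 1)) : b = d := by
  have hdiff : (fun r => (b - d) * r ^ n) =O[𝓝[>] 0] fun r => r ^ (n + 1) :=
    (hd.sub hb).congr_left fun r => by ring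
  exact sub_eq_zero.1 (eq_zero_of_mul_pow_isBigO n.lt_succ_self hdiff)

lemma IsFirstTerm.eq_zero_iff (hF : IsFirstTerm x F) (hG : IsFirstTerm x G) (θ : ℝ) :
    F θ = 0 ↔ G θ = 0 := by
  obtain ⟨hF0, m, x₀, hx₀, hF⟩ := hF
  obtain ⟨hG0, n, y₀, hy₀, hG⟩ := hG
  obtain ⟨θ₁, hθ₁⟩ := Function.ne_iff.1 hF0
  obtain ⟨θ₂, hθ₂⟩ := Function.ne_iff.1 hG0
  obtain rfl : m = n := le_antisymm
    (exponent_le_of_isBigO (mul_ne_zero hθ₂ (hy₀ θ₂)) (hG θ₂) (hF θ₂))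
    (exponent_le_of_isBigO (mul_ne_zero hθ₁ (hx₀ θ₁)) (hF θ₁) (hG θ₁))
  rw [← mul_eq_zero_iff_right (hx₀ θ), coeff_eq_of_isBigO (hF θ) (hG θ),
    mul_eq_zero_iff_right (hy₀ θ)]

end LeadingTerm

section Cross

/-- The cross product as a continuous bilinear map. -/
def crossL : E3 →L[ℝ] E3 →L[ℝ] E3 :=
  (LinearMap.mk₂ ℝ cross (fun x y z => by simp [cross]) (fun c x y => by simp [cross])
    (fun x y z => by simp [cross]) (fun c x y => by simp [cross])).toContinuousBilinearMap

lemma crossL_apply (x y : E3) : crossL x y = cross x y := rfl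

lemma cross_eq (x y : E3) :
    cross x y = !₂[x 1 * y 2 - x 2 * y 1, x 2 * y 0 - x 0 * y 2, x 0 * y 1 - x 1 * y 0] :=
  congrArg (WithLp.toLp 2) (cross_apply _ _)

lemma inner_self_cross (x y : E3) : ⟪x, cross x y⟫ = 0 := by
  rw [PiLp.inner_apply, Fin.sum_univ_three, cross_eq]
  simp only [Matrix.cons_val, RCLike.inner_apply, Real.ringHom_apply]
  ring

lemma inner_cross_self (x y : E3) : ⟪y, cross x y⟫ = 0 := by
  rw [PiLp.inner_apply, Fin.sum_univ_three, cross_eq]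
  simp only [Matrix.cons_val, RCLike.inner_apply, Real.ringHom_apply]
  ring

lemma norm_cross_sq (x y : E3) : ‖cross x y‖ ^ 2 = ‖x‖ ^ 2 * ‖y‖ ^ 2 - ⟪x, y⟫ ^ 2 := by
  simp only [EuclideanSpace.real_norm_sq_eq, PiLp.inner_apply, Fin.sum_univ_three, cross_eq]
  simp only [Matrix.cons_val, RCLike.inner_apply, Real.ringHom_apply]
  ring

lemma norm_cross_le (x y : E3) : ‖cross x y‖ ≤ ‖x‖ * ‖y‖ := by
  refine le_of_sq_le_sq ?_ (by positivity)
  rw [norm_cross_sq, mul_pow]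
  exact sub_le_self _ (sq_nonneg _)

lemma cross_linear_combination (x y : E3) (a b c d : ℝ) :
    cross (a • x + b • y) (c • x + d • y) = (a * d - b * c) • cross x y := by
  ext i
  fin_cases i <;> simp [cross_eq] <;> ring

lemma map_eq_smul_add_smul (A : ℝ × ℝ →L[ℝ] E3) (w : ℝ × ℝ) :
    A w = w.1 • A (1, 0) + w.2 • A (0, 1) := by
  rw [← map_smul, ← map_smul, ← map_add]
  simp

lemma cross_map_map (A : ℝ × ℝ →L[ℝ] E3) (v w : ℝ × ℝ) :
    cross (A v) (A w) = (v.1 * w.2 - v.2 * w.1) • cross (A (1, 0)) (A (0, 1)) := by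
  rw [map_eq_smul_add_smul A v, map_eq_smul_add_smul A w, cross_linear_combination]

lemma eq_zero_of_map_eq_zero {A : ℝ × ℝ →L[ℝ] E3} (hA : cross (A (1, 0)) (A (0, 1)) ≠ 0)
    {w : ℝ × ℝ} (hw : A w = 0) : w = 0 := by
  have hzero : ∀ v : ℝ × ℝ, w.1 * v.2 - w.2 * v.1 = 0 := fun v => by
    have hcross := (cross_map_map A w v).symm
    rw [hw, ← crossL_apply 0, map_zero, zero_apply] at hcross
    exact (smul_eq_zero.1 hcross).resolve_right hA
  exact Prod.ext (by simpa using hzero (0, 1)) (by simpa using hzero (1, 0))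

lemma cross_map_polar_one (A : ℝ × ℝ →L[ℝ] E3) (θ : ℝ) :
    cross (A (polar 1 θ)) (A (polar 1 (θ + Real.pi / 2))) = cross (A (1, 0)) (A (0, 1)) := by
  have hdet : (polar 1 θ).1 * (polar 1 (θ + Real.pi / 2)).2
      - (polar 1 θ).2 * (polar 1 (θ + Real.pi / 2)).1 = 1 := by
    simp [polar, Real.cos_add_pi_div_two, Real.sin_add_pi_div_two, ← pow_two]
  rw [cross_map_map, hdet, one_smul]

end Cross

section Curve

section Normalize

variable {V : Type*} [NormedAddCommGroup V] [InnerProductSpace ℝ V] {N : ℝ → V} {N' : V} {θ : ℝ}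

lemma hasDerivAt_norm (hN : HasDerivAt N N' θ) (h0 : N θ ≠ 0) :
    HasDerivAt (fun t => ‖N t‖) (⟪N θ, N'⟫ / ‖N θ‖) θ := by
  have hsqrt := hN.norm_sq.sqrt (pow_ne_zero 2 (norm_ne_zero_iff.2 h0))
  simp only [Real.sqrt_sq (norm_nonneg _)] at hsqrt
  rwa [mul_div_mul_left _ _ two_ne_zero] at hsqrt

lemma norm_sq_deriv_normalize (hN : HasDerivAt N N' θ) (h0 : N θ ≠ 0) :
    ‖deriv (fun t => NormedSpace.normalize (N t)) θ‖ ^ 2 =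
      (‖N θ‖ ^ 2 * ‖N'‖ ^ 2 - ⟪N θ, N'⟫ ^ 2) / ‖N θ‖ ^ 4 := by
  have hne : ‖N θ‖ ≠ 0 := norm_ne_zero_iff.2 h0
  have hderiv := (((hasDerivAt_norm hN h0).fun_inv hne).fun_smul hN).deriv
  rw [show (fun t => NormedSpace.normalize (N t)) = fun t => ‖N t‖⁻¹ • N t from rfl, hderiv,
    norm_add_sq_real]
  simp only [real_inner_smul_right, real_inner_smul_left, real_inner_comm (N θ) N', norm_smul,
    mul_pow, Real.norm_eq_abs, sq_abs]
  field_simp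
  ring

end Normalize

variable {γ n : ℝ → E3} {θ : ℝ}

lemma norm_deriv_normalize {N : ℝ → E3} {N' : E3} (hN : HasDerivAt N N' θ) (h0 : N θ ≠ 0) :
    ‖deriv (fun t => NormedSpace.normalize (N t)) θ‖ = ‖cross (N θ) N'‖ / ‖N θ‖ ^ 2 := by
  rw [← sq_eq_sq₀ (norm_nonneg _) (by positivity), norm_sq_deriv_normalize hN h0, div_pow,
    norm_cross_sq, ← pow_mul]

lemma speed_mul_kappa2 (hγ : DifferentiableAt ℝ (deriv γ) θ) (h0 : deriv γ θ ≠ 0)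
    (horth : ⟪deriv γ θ, n θ⟫ = 0) :
    speed γ θ * kappa2 γ n θ = ⟪deriv (deriv γ) θ, n θ⟫ := by
  have hs : speed γ θ ≠ 0 := norm_ne_zero_iff.2 h0
  have hspeed : DifferentiableAt ℝ (fun t => (speed γ t)⁻¹) θ := (hγ.norm ℝ h0).inv hs
  have htangent := (hspeed.hasDerivAt.fun_smul hγ.hasDerivAt).deriv
  rw [kappa2, show tangent γ = fun t => (speed γ t)⁻¹ • deriv γ t from rfl, htangent,
    inner_add_left, real_inner_smul_left, real_inner_smul_left, horth, mul_zero, add_zero,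
    mul_inv_cancel_left₀ hs]

lemma inner_deriv_eq_neg_inner_deriv_deriv (hγ : DifferentiableAt ℝ (deriv γ) θ)
    (hn : DifferentiableAt ℝ n θ) (horth : ∀ᶠ t in 𝓝 θ, ⟪deriv γ t, n t⟫ = 0) :
    ⟪deriv γ θ, deriv n θ⟫ = -⟪deriv (deriv γ) θ, n θ⟫ := by
  have hprod := hγ.hasDerivAt.inner ℝ hn.hasDerivAt
  have hzero : HasDerivAt (fun t => ⟪deriv γ t, n t⟫) 0 θ :=
    (hasDerivAt_const θ (0 : ℝ)).congr_of_eventuallyEq horth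
  exact eq_neg_of_add_eq_zero_left (hprod.unique hzero)

lemma strictionCoeff_eq (hγ : DifferentiableAt ℝ (deriv γ) θ) (h0 : deriv γ θ ≠ 0)
    (hn : DifferentiableAt ℝ n θ) (horth : ∀ᶠ t in 𝓝 θ, ⟪deriv γ t, n t⟫ = 0) :
    strictionCoeff γ n θ = speed γ θ * kappa2 γ n θ / ‖deriv n θ‖ ^ 2 := by
  rw [strictionCoeff, inner_deriv_eq_neg_inner_deriv_deriv hγ hn horth, neg_div, neg_neg,
    real_inner_self_eq_norm_sq, speed_mul_kappa2 hγ h0 horth.self_of_nhds]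

end Curve

section Surface

variable {f : ℝ × ℝ → E3} {p : ℝ × ℝ} {r θ : ℝ}

lemma inner_fderiv_normal (f : ℝ × ℝ → E3) (p w : ℝ × ℝ) : ⟪fderiv ℝ f p w, normal f p⟫ = 0 := by
  rw [map_eq_smul_add_smul, normal, inner_add_left, real_inner_smul_left, real_inner_smul_left,
    inner_self_cross, inner_cross_self, mul_zero, mul_zero, add_zero]

lemma normal_eq_crossL (f : ℝ × ℝ → E3) :
    normal f = fun p => crossL (fderiv ℝ f p (1, 0)) (fderiv ℝ f p (0, 1)) := rfl

lemma contDiffAt_normal {m n : WithTop ℕ∞} (hf : ContDiffAt ℝ n f p) (hmn : m + 1 ≤ n) :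
    ContDiffAt ℝ m (normal f) p := by
  have hf' := hf.fderiv_right hmn
  exact (crossL.contDiff.contDiffAt.comp p (hf'.clm_apply contDiffAt_const)).clm_apply
    (hf'.clm_apply contDiffAt_const)

lemma differentiableAt_normal (hf : ContDiffAt ℝ 2 f p) : DifferentiableAt ℝ (normal f) p :=
  (contDiffAt_normal (m := 1) hf (by norm_num)).differentiableAt one_ne_zero

lemma fderiv_normal_apply (hf : ContDiffAt ℝ 2 f p) (w : ℝ × ℝ) :
    fderiv ℝ (normal f) p w =
      cross (fderiv ℝ f p (1, 0)) (fderiv ℝ (fderiv ℝ f) p w (0, 1)) +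
        cross (fderiv ℝ (fderiv ℝ f) p w (1, 0)) (fderiv ℝ f p (0, 1)) := by
  have hf' := ((hf.fderiv_right (m := 1) (by norm_num)).differentiableAt one_ne_zero).hasFDerivAt
  have hpartial : ∀ v, HasFDerivAt (fun q => fderiv ℝ f q v)
      ((fderiv ℝ (fderiv ℝ f) p).flip v) p := fun v => by
    simpa using hf'.clm_apply (hasFDerivAt_const v p)
  rw [normal_eq_crossL, (crossL.hasFDerivAt_of_bilinear (hpartial _) (hpartial _)).fderiv]
  simp [crossL_apply]

lemma hasDerivAt_comp_polar {E : Type*} [NormedAddCommGroup E] [NormedSpace ℝ E] {G : ℝ × ℝ → E}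
    (hG : DifferentiableAt ℝ G (polar r θ)) :
    HasDerivAt (fun t => G (polar r t)) (fderiv ℝ G (polar r θ) (polar r (θ + Real.pi / 2))) θ :=
  hG.hasFDerivAt.comp_hasDerivAt θ (hasDerivAt_polar r θ)

lemma eventually_deriv_curve (hf : ContDiffAt ℝ 1 f (polar r θ)) :
    ∀ᶠ t in 𝓝 θ, deriv (curve f r) t = fderiv ℝ f (polar r t) (polar r (t + Real.pi / 2)) :=
  ((hasDerivAt_polar r θ).continuousAt.eventually (eventually_differentiableAt hf)).mono
    fun _ ht => (hasDerivAt_comp_polar ht).deriv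

lemma hasDerivAt_deriv_curve (hf : ContDiffAt ℝ 2 f (polar r θ)) :
    HasDerivAt (deriv (curve f r))
      (fderiv ℝ (fderiv ℝ f) (polar r θ) (polar r (θ + Real.pi / 2)) (polar r (θ + Real.pi / 2))
        - fderiv ℝ f (polar r θ) (polar r θ)) θ := by
  have hf' : DifferentiableAt ℝ (fderiv ℝ f) (polar r θ) :=
    (hf.fderiv_right (m := 1) (by norm_num)).differentiableAt one_ne_zero
  have hpolar : HasDerivAt (fun t => polar r (t + Real.pi / 2)) (-polar r θ) θ := by
    simpa only [polar_add_pi_div_two_add_pi_div_two] using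
      (hasDerivAt_polar r (θ + Real.pi / 2)).comp_add_const θ (Real.pi / 2)
  have hderiv := (hasDerivAt_comp_polar hf').clm_apply hpolar
  rw [map_neg, ← sub_eq_add_neg] at hderiv
  exact hderiv.congr_of_eventuallyEq (eventually_deriv_curve (hf.of_le one_le_two))

lemma eventually_inner_deriv_curve_normalAlong (hf : ContDiffAt ℝ 1 f (polar r θ)) :
    ∀ᶠ t in 𝓝 θ, ⟪deriv (curve f r) t, normalAlong f r t⟫ = 0 :=
  (eventually_deriv_curve hf).mono fun t ht => by
    rw [ht, normalAlong, unitNormal, real_inner_smul_right, inner_fderiv_normal, mul_zero]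

lemma polar_ne_zero (hr : r ≠ 0) (θ : ℝ) : polar r θ ≠ 0 := fun h => by
  have hcos : Real.cos θ = 0 := (mul_eq_zero.1 (congrArg Prod.fst h)).resolve_left hr
  have hsin : Real.sin θ = 0 := (mul_eq_zero.1 (congrArg Prod.snd h)).resolve_left hr
  simpa [hcos, hsin] using Real.cos_sq_add_sin_sq θ

lemma deriv_curve_ne_zero (hf : ContDiffAt ℝ 1 f (polar r θ)) (hr : r ≠ 0)
    (hN : normal f (polar r θ) ≠ 0) : deriv (curve f r) θ ≠ 0 := by
  rw [(eventually_deriv_curve hf).self_of_nhds]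
  exact fun h => polar_ne_zero hr _ (eq_zero_of_map_eq_zero hN h)

lemma differentiableAt_normalAlong (hf : ContDiffAt ℝ 2 f (polar r θ))
    (hN : normal f (polar r θ) ≠ 0) : DifferentiableAt ℝ (normalAlong f r) θ := by
  have hd := (hasDerivAt_comp_polar (differentiableAt_normal hf)).differentiableAt
  exact ((hd.norm ℝ hN).inv (norm_ne_zero_iff.2 hN)).smul hd

lemma kappaHat2_eq (hf : ContDiffAt ℝ 2 f (polar r θ)) (hr : r ≠ 0)
    (hN : normal f (polar r θ) ≠ 0) :
    kappaHat2 f r θ = ⟪fderiv ℝ (fderiv ℝ f) (polar r θ) (polar r (θ + Real.pi / 2))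
      (polar r (θ + Real.pi / 2)), normal f (polar r θ)⟫ / ‖normal f (polar r θ)‖ := by
  have hf₁ := hf.of_le one_le_two
  rw [kappaHat2, speed_mul_kappa2 (hasDerivAt_deriv_curve hf).differentiableAt
    (deriv_curve_ne_zero hf₁ hr hN) (eventually_inner_deriv_curve_normalAlong hf₁).self_of_nhds,
    (hasDerivAt_deriv_curve hf).deriv, normalAlong, unitNormal, real_inner_smul_right,
    inner_sub_left, inner_fderiv_normal, sub_zero, inv_mul_eq_div]

lemma norm_deriv_normalAlong (hf : ContDiffAt ℝ 2 f (polar r θ)) (hN : normal f (polar r θ) ≠ 0) :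
    ‖deriv (normalAlong f r) θ‖ = ‖cross (normal f (polar r θ))
      (fderiv ℝ (normal f) (polar r θ) (polar r (θ + Real.pi / 2)))‖ / ‖normal f (polar r θ)‖ ^ 2 :=
  norm_deriv_normalize (N := fun t => normal f (polar r t))
    (hasDerivAt_comp_polar (differentiableAt_normal hf)) hN

lemma beta_eq (hf : ContDiffAt ℝ 2 f (polar r θ)) (hr : r ≠ 0) (hN : normal f (polar r θ) ≠ 0) :
    beta f r θ = kappaHat2 f r θ / ‖deriv (normalAlong f r) θ‖ ^ 2 :=
  strictionCoeff_eq (hasDerivAt_deriv_curve hf).differentiableAt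
    (deriv_curve_ne_zero (hf.of_le one_le_two) hr hN) (differentiableAt_normalAlong hf hN)
    (eventually_inner_deriv_curve_normalAlong (hf.of_le one_le_two))

end Surface

section UmbrellaPoint

variable {f : ℝ × ℝ → E3}

lemma isBoundedApprox_polar_apply {E : Type*} [NormedAddCommGroup E] [NormedSpace ℝ E]
    {x c : ℝ × ℝ → ℝ × ℝ →L[ℝ] E} (h : IsBoundedApprox polarFilter Prod.fst x c) :
    IsBoundedApprox polarFilter Prod.fst (fun q => x q (polar 1 (q.2 + Real.pi / 2)))
      fun q => c q (polar 1 (q.2 + Real.pi / 2)) := by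
  have hpolar : IsBoundedApprox polarFilter Prod.fst
      (fun q => polar 1 (q.2 + Real.pi / 2)) fun q => polar 1 (q.2 + Real.pi / 2) :=
    .refl <| isBigO_one_polarFilter (u := fun θ => polar 1 (θ + Real.pi / 2))
      fun _ => norm_polar_one_le _
  simpa only [ContinuousLinearMap.id_apply] using
    h.bilinear hpolar tendsto_fst_polarFilter (ContinuousLinearMap.id ℝ (ℝ × ℝ →L[ℝ] E))

lemma isBoundedApprox_fderiv_fderiv (hf : ContDiffAt ℝ 3 f 0) :
    IsBoundedApprox polarFilter Prod.fst
      (fun q => fderiv ℝ (fderiv ℝ f) (polar q.1 q.2) (polar 1 (q.2 + Real.pi / 2))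
        (polar 1 (q.2 + Real.pi / 2)))
      fun q => fderiv ℝ (fderiv ℝ f) 0 (polar 1 (q.2 + Real.pi / 2))
        (polar 1 (q.2 + Real.pi / 2)) := by
  have hd : DifferentiableAt ℝ (fderiv ℝ (fderiv ℝ f)) 0 :=
    ((hf.fderiv_right (m := 2) (by norm_num)).fderiv_right (m := 1) (by norm_num)).differentiableAt
      one_ne_zero
  exact isBoundedApprox_polar_apply (isBoundedApprox_polar_apply (isBoundedApprox_comp_polar hd))

lemma isBoundedApprox_fderiv_normal (hf : ContDiffAt ℝ 3 f 0) :
    IsBoundedApprox polarFilter Prod.fst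
      (fun q => fderiv ℝ (normal f) (polar q.1 q.2) (polar 1 (q.2 + Real.pi / 2)))
      fun q => fderiv ℝ (normal f) 0 (polar 1 (q.2 + Real.pi / 2)) :=
  isBoundedApprox_polar_apply (isBoundedApprox_comp_polar
    (((contDiffAt_normal (m := 2) hf (by norm_num)).fderiv_right (m := 1)
      (by norm_num)).differentiableAt one_ne_zero))

lemma isBoundedApprox_inv_smul_normal (hf : ContDiffAt ℝ 3 f 0) (h0 : normal f 0 = 0) :
    IsBoundedApprox polarFilter Prod.fst (fun q => q.1⁻¹ • normal f (polar q.1 q.2))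
      fun q => fderiv ℝ (normal f) 0 (polar 1 q.2) :=
  isBoundedApprox_inv_smul_comp_polar (contDiffAt_normal hf (by norm_num)) h0

lemma one_isBigO_norm_map_polar_one {A : ℝ × ℝ →L[ℝ] E3}
    (hA : cross (A (1, 0)) (A (0, 1)) ≠ 0) :
    (fun _ => (1 : ℝ)) =O[polarFilter] fun q => ‖A (polar 1 q.2)‖ := by
  refine IsBigO.of_bound (‖A‖ / ‖cross (A (1, 0)) (A (0, 1))‖) (Eventually.of_forall fun q => ?_)
  rw [norm_one, norm_norm, div_mul_eq_mul_div, one_le_div (norm_pos_iff.2 hA),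
    ← cross_map_polar_one A q.2, mul_comm]
  exact (norm_cross_le _ _).trans (by
    gcongr
    exact A.unit_le_opNorm _ (norm_polar_one_le _))

lemma one_isBigO_div_norm_map_polar_one_sq {A : ℝ × ℝ →L[ℝ] E3}
    (hA : cross (A (1, 0)) (A (0, 1)) ≠ 0) :
    (fun _ => (1 : ℝ)) =O[polarFilter] fun q =>
      ‖cross (A (1, 0)) (A (0, 1))‖ / ‖A (polar 1 q.2)‖ ^ 2 := by
  refine IsBigO.of_bound (‖A‖ ^ 2 / ‖cross (A (1, 0)) (A (0, 1))‖)
    (Eventually.of_forall fun q => ?_)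
  have hA' := norm_pos_iff.2 hA
  have hq : 0 < ‖A (polar 1 q.2)‖ := norm_pos_iff.2 fun h =>
    polar_ne_zero one_ne_zero q.2 (eq_zero_of_map_eq_zero hA h)
  rw [norm_one, Real.norm_of_nonneg (by positivity), div_mul_div_cancel₀ hA'.ne',
    one_le_div (by positivity)]
  gcongr
  exact A.unit_le_opNorm _ (norm_polar_one_le _)

lemma eventually_normal_ne_zero (hf : ContDiffAt ℝ 3 f 0) (h0 : normal f 0 = 0)
    (hcross : cross (fderiv ℝ (normal f) 0 (1, 0)) (fderiv ℝ (normal f) 0 (0, 1)) ≠ 0) :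
    ∀ᶠ q in polarFilter, normal f (polar q.1 q.2) ≠ 0 :=
  (eventually_ne_zero_of_one_isBigO ((isBoundedApprox_inv_smul_normal hf h0).norm.one_isBigO_left
    tendsto_fst_polarFilter (one_isBigO_norm_map_polar_one hcross))).mono fun q hq hN =>
      hq (by rw [hN, smul_zero, norm_zero])

lemma eventually_contDiffAt_polar (hf : ContDiffAt ℝ 3 f 0) :
    ∀ᶠ q in polarFilter, ContDiffAt ℝ 2 f (polar q.1 q.2) :=
  tendsto_polar.eventually ((hf.of_le (by norm_num)).eventually (by simp))

lemma isBoundedApprox_kappaHat2_div_sq (hf : ContDiffAt ℝ 3 f 0) (h0 : normal f 0 = 0)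
    (hcross : cross (fderiv ℝ (normal f) 0 (1, 0)) (fderiv ℝ (normal f) 0 (0, 1)) ≠ 0) :
    IsBoundedApprox polarFilter Prod.fst (fun q => kappaHat2 f q.1 q.2 / q.1 ^ 2)
      fun q => ⟪fderiv ℝ (fderiv ℝ f) 0 (polar 1 (q.2 + Real.pi / 2)) (polar 1 (q.2 + Real.pi / 2)),
        fderiv ℝ (normal f) 0 (polar 1 q.2)⟫ / ‖fderiv ℝ (normal f) 0 (polar 1 q.2)‖ := by
  have hnormal := isBoundedApprox_inv_smul_normal hf h0
  have hinner := (isBoundedApprox_fderiv_fderiv hf).bilinear hnormal tendsto_fst_polarFilter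
    (innerSL ℝ)
  have hinv := hnormal.norm.inv tendsto_fst_polarFilter (one_isBigO_norm_map_polar_one hcross)
  refine (hinner.mul hinv tendsto_fst_polarFilter).congr ?_ fun q => (div_eq_mul_inv _ _).symm
  filter_upwards [eventually_normal_ne_zero hf h0 hcross, eventually_contDiffAt_polar hf,
    eventually_fst_pos] with q hN hq hr
  rw [kappaHat2_eq hq hr.ne' hN, polar_eq_smul q.1 (q.2 + Real.pi / 2)]
  rw [innerSL_apply_apply]
  simp only [map_smul, smul_apply, real_inner_smul_left, real_inner_smul_right, norm_smul,
    norm_inv, Real.norm_of_nonneg hr.le]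
  field_simp

lemma isBoundedApprox_norm_deriv_normalAlong (hf : ContDiffAt ℝ 3 f 0) (h0 : normal f 0 = 0)
    (hcross : cross (fderiv ℝ (normal f) 0 (1, 0)) (fderiv ℝ (normal f) 0 (0, 1)) ≠ 0) :
    IsBoundedApprox polarFilter Prod.fst (fun q => ‖deriv (normalAlong f q.1) q.2‖)
      fun q => ‖cross (fderiv ℝ (normal f) 0 (1, 0)) (fderiv ℝ (normal f) 0 (0, 1))‖
        / ‖fderiv ℝ (normal f) 0 (polar 1 q.2)‖ ^ 2 := by
  have hg := tendsto_fst_polarFilter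
  have hnormal := isBoundedApprox_inv_smul_normal hf h0
  have hcross' := (hnormal.bilinear (isBoundedApprox_fderiv_normal hf) hg crossL).norm
  have hinv := hnormal.norm.inv hg (one_isBigO_norm_map_polar_one hcross)
  refine (hcross'.mul (hinv.mul hinv hg) hg).congr ?_ fun q => ?_
  · filter_upwards [eventually_normal_ne_zero hf h0 hcross, eventually_contDiffAt_polar hf,
      eventually_fst_pos] with q hN hq hr
    rw [norm_deriv_normalAlong hq hN, polar_eq_smul q.1 (q.2 + Real.pi / 2)]
    simp only [← crossL_apply, map_smul, smul_apply, norm_smul, norm_inv,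
      Real.norm_of_nonneg hr.le]
    field_simp
  · rw [crossL_apply, cross_map_polar_one]
    field_simp

lemma isBoundedApprox_beta_div_sq (hf : ContDiffAt ℝ 3 f 0) (h0 : normal f 0 = 0)
    (hcross : cross (fderiv ℝ (normal f) 0 (1, 0)) (fderiv ℝ (normal f) 0 (0, 1)) ≠ 0) :
    IsBoundedApprox polarFilter Prod.fst (fun q => beta f q.1 q.2 / q.1 ^ 2)
      fun q => ⟪fderiv ℝ (fderiv ℝ f) 0 (polar 1 (q.2 + Real.pi / 2)) (polar 1 (q.2 + Real.pi / 2)),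
        fderiv ℝ (normal f) 0 (polar 1 q.2)⟫ * ‖fderiv ℝ (normal f) 0 (polar 1 q.2)‖ ^ 3
          / ‖cross (fderiv ℝ (normal f) 0 (1, 0)) (fderiv ℝ (normal f) 0 (0, 1))‖ ^ 2 := by
  have hg := tendsto_fst_polarFilter
  have hinj : ∀ θ, fderiv ℝ (normal f) 0 (polar 1 θ) ≠ 0 := fun θ h =>
    polar_ne_zero one_ne_zero θ (eq_zero_of_map_eq_zero hcross h)
  have hinv := (isBoundedApprox_norm_deriv_normalAlong hf h0 hcross).inv hg
    (one_isBigO_div_norm_map_polar_one_sq hcross)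
  refine ((isBoundedApprox_kappaHat2_div_sq hf h0 hcross).mul (hinv.mul hinv hg) hg).congr ?_
    fun q => ?_
  · filter_upwards [eventually_normal_ne_zero hf h0 hcross, eventually_contDiffAt_polar hf,
      eventually_fst_pos] with q hN hq hr
    rw [beta_eq hq hr.ne' hN]
    field_simp
  · have hnorm := norm_ne_zero_iff.2 (hinj q.2)
    field_simp

end UmbrellaPoint

section Whitney

variable {a : ℕ → ℕ → ℝ} {f : ℝ × ℝ → E3}

/-- The 2-jet at the origin of the normal form of a Whitney umbrella with coefficients `a`. -/
def whitneyJet (a : ℕ → ℕ → ℝ) (p : ℝ × ℝ) : E3 :=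
  !₂[p.1, p.1 * p.2, a 2 0 / 2 * p.1 ^ 2 + a 1 1 * (p.1 * p.2) + a 0 2 / 2 * p.2 ^ 2]

/-- The linear part of `whitneyJet`. -/
def whitneyLinear : ℝ × ℝ →L[ℝ] E3 :=
  (ContinuousLinearMap.fst ℝ ℝ ℝ).smulRight !₂[1, 0, 0]

/-- The second derivative of `whitneyJet`. -/
def whitneyHessian (a : ℕ → ℕ → ℝ) : ℝ × ℝ →L[ℝ] ℝ × ℝ →L[ℝ] E3 :=
  (LinearMap.mk₂ ℝ (fun v w : ℝ × ℝ => (!₂[0, v.1 * w.2 + v.2 * w.1,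
      a 2 0 * (v.1 * w.1) + a 1 1 * (v.1 * w.2 + v.2 * w.1) + a 0 2 * (v.2 * w.2)] : E3))
    (fun v v' w => by ext i; fin_cases i <;> simp <;> ring)
    (fun c v w => by ext i; fin_cases i <;> simp <;> ring)
    (fun v w w' => by ext i; fin_cases i <;> simp <;> ring)
    (fun c v w => by ext i; fin_cases i <;> simp <;> ring)).toContinuousBilinearMap

lemma whitneyLinear_apply (w : ℝ × ℝ) : whitneyLinear w = !₂[w.1, 0, 0] := by
  ext i
  fin_cases i <;> simp [whitneyLinear]

lemma whitneyHessian_apply (a : ℕ → ℕ → ℝ) (v w : ℝ × ℝ) :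
    whitneyHessian a v w = !₂[0, v.1 * w.2 + v.2 * w.1,
      a 2 0 * (v.1 * w.1) + a 1 1 * (v.1 * w.2 + v.2 * w.1) + a 0 2 * (v.2 * w.2)] := rfl

lemma whitneyHessian_comm (a : ℕ → ℕ → ℝ) (v w : ℝ × ℝ) :
    whitneyHessian a v w = whitneyHessian a w v := by
  rw [whitneyHessian_apply, whitneyHessian_apply]
  ext i
  fin_cases i <;> simp <;> ring

lemma whitneyJet_eq (a : ℕ → ℕ → ℝ) (p : ℝ × ℝ) :
    whitneyJet a p = whitneyLinear p + (1 / 2 : ℝ) • whitneyHessian a p p := by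
  rw [whitneyJet, whitneyLinear_apply, whitneyHessian_apply]
  ext i
  fin_cases i <;> simp <;> ring

lemma fderiv_eq_of_isBigO_sub_whitneyJet (hf : ContDiffAt ℝ 3 f 0)
    (hjet : (fun p => f p - whitneyJet a p) =O[𝓝 0] fun p => ‖p‖ ^ 3) :
    fderiv ℝ f 0 = whitneyLinear ∧ fderiv ℝ (fderiv ℝ f) 0 = whitneyHessian a := by
  refine (eq_taylor_coeffs_of_isBigO hf (c := 0) (whitneyHessian_comm a) ?_).2
  simpa only [sub_zero, zero_add, ← whitneyJet_eq] using hjet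

section Jet

variable (hℓ : fderiv ℝ f 0 = whitneyLinear) (hB : fderiv ℝ (fderiv ℝ f) 0 = whitneyHessian a)
include hℓ

lemma normal_zero_eq_zero : normal f 0 = 0 := by
  rw [normal, hℓ, cross_eq]
  ext i
  fin_cases i <;> simp [whitneyLinear_apply]

include hB

lemma fderiv_normal_zero_apply (hf : ContDiffAt ℝ 2 f 0) (w : ℝ × ℝ) :
    fderiv ℝ (normal f) 0 w = !₂[0, -(a 1 1 * w.1 + a 0 2 * w.2), w.1] := by
  rw [fderiv_normal_apply hf, hℓ, hB, cross_eq, cross_eq]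
  ext i
  fin_cases i <;> simp [whitneyLinear_apply, whitneyHessian_apply]

lemma norm_fderiv_normal_zero_polar (hf : ContDiffAt ℝ 2 f 0) (θ : ℝ) :
    ‖fderiv ℝ (normal f) 0 (polar 1 θ)‖ = calA a θ := by
  rw [fderiv_normal_zero_apply hℓ hB hf, EuclideanSpace.norm_eq, Fin.sum_univ_three, calA]
  simp [polar, add_comm, -neg_add_rev]

lemma cross_fderiv_normal_zero (hf : ContDiffAt ℝ 2 f 0) :
    cross (fderiv ℝ (normal f) 0 (1, 0)) (fderiv ℝ (normal f) 0 (0, 1)) = !₂[a 0 2, 0, 0] := by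
  rw [cross_eq]
  ext i
  fin_cases i <;> simp [fderiv_normal_zero_apply hℓ hB hf]

lemma cross_fderiv_normal_zero_ne_zero (hf : ContDiffAt ℝ 2 f 0) (ha : a 0 2 ≠ 0) :
    cross (fderiv ℝ (normal f) 0 (1, 0)) (fderiv ℝ (normal f) 0 (0, 1)) ≠ 0 := fun h =>
  ha (by simpa [cross_fderiv_normal_zero hℓ hB hf] using congrArg (fun v : E3 => v 0) h)

lemma norm_cross_fderiv_normal_zero (hf : ContDiffAt ℝ 2 f 0) :
    ‖cross (fderiv ℝ (normal f) 0 (1, 0)) (fderiv ℝ (normal f) 0 (0, 1))‖ ^ 2 = a 0 2 ^ 2 := by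
  rw [cross_fderiv_normal_zero hℓ hB hf, EuclideanSpace.real_norm_sq_eq, Fin.sum_univ_three]
  simp

lemma inner_fderiv_fderiv_zero_fderiv_normal_zero (hf : ContDiffAt ℝ 2 f 0) (θ : ℝ) :
    ⟪fderiv ℝ (fderiv ℝ f) 0 (polar 1 (θ + Real.pi / 2)) (polar 1 (θ + Real.pi / 2)),
      fderiv ℝ (normal f) 0 (polar 1 θ)⟫ = FkappaHat2 a θ := by
  rw [fderiv_normal_zero_apply hℓ hB hf, hB, whitneyHessian_apply, PiLp.inner_apply,
    Fin.sum_univ_three]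
  simp only [polar, Real.cos_add_pi_div_two, Real.sin_add_pi_div_two, FkappaHat2, Matrix.cons_val,
    RCLike.inner_apply, Real.ringHom_apply]
  ring

end Jet

section LeadingTermOfJet

variable (hf : ContDiffAt ℝ 3 f 0)
  (hjet : (fun p => f p - whitneyJet a p) =O[𝓝 0] fun p => ‖p‖ ^ 3) (ha : a 0 2 ≠ 0)
include hf hjet ha

lemma hasLeadingTerm_kappaHat2 :
    HasLeadingTerm (kappaHat2 f) (fun θ => FkappaHat2 a θ / calA a θ) 2 := by
  obtain ⟨hℓ, hB⟩ := fderiv_eq_of_isBigO_sub_whitneyJet hf hjet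
  have hf₂ : ContDiffAt ℝ 2 f 0 := hf.of_le (by norm_num)
  have happrox := isBoundedApprox_kappaHat2_div_sq hf (normal_zero_eq_zero hℓ)
    (cross_fderiv_normal_zero_ne_zero hℓ hB hf₂ ha)
  simp only [inner_fderiv_fderiv_zero_fderiv_normal_zero hℓ hB hf₂,
    norm_fderiv_normal_zero_polar hℓ hB hf₂] at happrox
  exact hasLeadingTerm_of_isBoundedApprox happrox

lemma hasLeadingTerm_beta :
    HasLeadingTerm (beta f) (fun θ => FkappaHat2 a θ * calA a θ ^ 3 / a 0 2 ^ 2) 2 := by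
  obtain ⟨hℓ, hB⟩ := fderiv_eq_of_isBigO_sub_whitneyJet hf hjet
  have hf₂ : ContDiffAt ℝ 2 f 0 := hf.of_le (by norm_num)
  have happrox := isBoundedApprox_beta_div_sq hf (normal_zero_eq_zero hℓ)
    (cross_fderiv_normal_zero_ne_zero hℓ hB hf₂ ha)
  simp only [inner_fderiv_fderiv_zero_fderiv_normal_zero hℓ hB hf₂,
    norm_fderiv_normal_zero_polar hℓ hB hf₂, norm_cross_fderiv_normal_zero hℓ hB hf₂] at happrox
  exact hasLeadingTerm_of_isBoundedApprox happrox

end LeadingTermOfJet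

lemma calA_ne_zero (ha : a 0 2 ≠ 0) (θ : ℝ) : calA a θ ≠ 0 := by
  refine Real.sqrt_ne_zero'.2 (lt_of_le_of_ne (by positivity) fun h => ?_)
  have hcos : Real.cos θ = 0 := by nlinarith [sq_nonneg (a 1 1 * Real.cos θ + a 0 2 * Real.sin θ)]
  have hsin : Real.sin θ = 0 := by simpa [hcos, ha] using h.symm
  simpa [hcos, hsin] using Real.cos_sq_add_sin_sq θ

lemma FkappaHat2_ne_zero (ha : a 0 2 ≠ 0) : FkappaHat2 a ≠ 0 := fun h =>
  ha (by simpa [FkappaHat2] using congrFun h 0)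

end Whitney

namespace IsNormalForm

variable {k : ℕ} {a : ℕ → ℕ → ℝ} {b : ℕ → ℝ} {f : ℝ × ℝ → E3}

lemma contDiffAt (hf : IsNormalForm k a b f) : ContDiffAt ℝ ∞ f 0 := by
  obtain ⟨U, hU, hsmooth⟩ := hf.smooth
  exact hsmooth.contDiffAt hU

lemma isBigO_snd_sub_whitneyJet (hf : IsNormalForm k a b f) (hk : 2 ≤ k) :
    (fun p => f p 1 - p.1 * p.2) =O[𝓝 0] fun p => ‖p‖ ^ 3 := by
  have hrest := hf.snd_eq.trans (isBigO_pow_pow_of_le tendsto_norm_zero (Nat.succ_le_succ hk))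
  have hhigher : (fun p : ℝ × ℝ => ∑ i ∈ Finset.Icc 3 k, b i / (i.factorial : ℝ) * p.2 ^ i)
      =O[𝓝 0] fun p => ‖p‖ ^ 3 :=
    IsBigO.fun_sum fun i hi => by
      simpa using isBigO_monomial (b i / (i.factorial : ℝ)) (i := 0) (j := i)
        (by simpa using (Finset.mem_Icc.1 hi).1)
  exact (hrest.add hhigher).congr_left fun p => by ring

lemma isBigO_thd_sub_whitneyJet (hf : IsNormalForm k a b f) (hk : 2 ≤ k) :
    (fun p => f p 2 - (a 2 0 / 2 * p.1 ^ 2 + a 1 1 * (p.1 * p.2) + a 0 2 / 2 * p.2 ^ 2))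
      =O[𝓝 0] fun p => ‖p‖ ^ 3 := by
  have hrest := hf.thd_eq.trans (isBigO_pow_pow_of_le tendsto_norm_zero (Nat.succ_le_succ hk))
  have hhigher : (fun p : ℝ × ℝ => ∑ j ∈ Finset.Icc 3 k, ∑ i ∈ Finset.range (j + 1),
        a i (j - i) / ((i.factorial : ℝ) * ((j - i).factorial : ℝ)) * p.1 ^ i * p.2 ^ (j - i))
      =O[𝓝 0] fun p => ‖p‖ ^ 3 :=
    IsBigO.fun_sum fun j hj => IsBigO.fun_sum fun i hi => isBigO_monomial _ (by
      rw [Finset.mem_Icc] at hj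
      rw [Finset.mem_range] at hi
      lia)
  refine (hrest.add hhigher).congr_left fun p => ?_
  rw [← Finset.add_sum_Ioc_eq_sum_Icc hk, ← Finset.Icc_add_one_left_eq_Ioc]
  simp only [Finset.sum_range_succ, Finset.range_one, Finset.sum_singleton, Nat.reduceAdd,
    Nat.reduceSub, Nat.factorial, Nat.cast_mul, Nat.cast_one, pow_zero]
  ring

lemma isBigO_sub_whitneyJet (hf : IsNormalForm k a b f) (hk : 2 ≤ k) :
    (fun p => f p - whitneyJet a p) =O[𝓝 0] fun p => ‖p‖ ^ 3 := by
  refine isBigO_euclideanSpace fun i => ?_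
  fin_cases i
  · refine (isBigO_zero _ _).congr' ?_ EventuallyEq.rfl
    filter_upwards [hf.fst_eq] with p hp
    simp [whitneyJet, hp]
  · simpa [whitneyJet] using hf.isBigO_snd_sub_whitneyJet hk
  · simpa [whitneyJet] using hf.isBigO_thd_sub_whitneyJet hk

end IsNormalForm

end WhitneyUmbrella

end

theorem mainTheorem5_general (a : ℕ → ℕ → ℝ) (f : ℝ × ℝ → WhitneyUmbrella.E3)
    (hf : ContDiffAt ℝ 3 f 0)
    (hjet : Asymptotics.IsBigO (𝓝 0) (fun p => f p - WhitneyUmbrella.whitneyJet a p)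
      fun p => ‖p‖ ^ 3)
    (ha : a 0 2 ≠ 0) :
    WhitneyUmbrella.HasLeadingTerm (WhitneyUmbrella.kappaHat2 f)
      (fun θ => WhitneyUmbrella.FkappaHat2 a θ / WhitneyUmbrella.calA a θ) 2 ∧
    WhitneyUmbrella.IsFirstTerm (WhitneyUmbrella.kappaHat2 f) (WhitneyUmbrella.FkappaHat2 a) ∧
    WhitneyUmbrella.HasLeadingTerm (WhitneyUmbrella.beta f)
      (fun θ => Real.cos θ * (a 0 2 * Real.cos θ ^ 2 + (2 * a 0 2 + a 2 0) * Real.sin θ ^ 2)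
        * WhitneyUmbrella.calA a θ ^ 3 / a 0 2 ^ 2) 2 ∧
    (∃ Fβ : ℝ → ℝ, WhitneyUmbrella.IsFirstTerm (WhitneyUmbrella.beta f) Fβ) ∧
    ∀ Fβ : ℝ → ℝ, WhitneyUmbrella.IsFirstTerm (WhitneyUmbrella.beta f) Fβ →
      ∀ θ : ℝ, WhitneyUmbrella.FkappaHat2 a θ = 0 ↔ Fβ θ = 0 := by
  have hκ := WhitneyUmbrella.hasLeadingTerm_kappaHat2 hf hjet ha
  have hβ := WhitneyUmbrella.hasLeadingTerm_beta hf hjet ha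
  have hF := WhitneyUmbrella.FkappaHat2_ne_zero ha
  have hA := WhitneyUmbrella.calA_ne_zero ha
  have hκ_first : WhitneyUmbrella.IsFirstTerm (WhitneyUmbrella.kappaHat2 f)
      (WhitneyUmbrella.FkappaHat2 a) :=
    WhitneyUmbrella.HasLeadingTerm.isFirstTerm hκ hF fun θ => inv_ne_zero (hA θ)
  have hβ_first : WhitneyUmbrella.IsFirstTerm (WhitneyUmbrella.beta f)
      (WhitneyUmbrella.FkappaHat2 a) := by
    simp only [mul_div_assoc] at hβ
    exact hβ.isFirstTerm hF fun θ => div_ne_zero (pow_ne_zero 3 (hA θ)) (pow_ne_zero 2 ha)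
  exact ⟨hκ, hκ_first, hβ, ⟨_, hβ_first⟩, fun Fβ hFβ => hβ_first.eq_zero_iff hFβ⟩

theorem mainTheorem5 (k : ℕ) (hk : 3 ≤ k) (a : ℕ → ℕ → ℝ) (b : ℕ → ℝ)
    (f : ℝ × ℝ → WhitneyUmbrella.E3) (hf : WhitneyUmbrella.IsNormalForm k a b f) :
    WhitneyUmbrella.HasLeadingTerm (WhitneyUmbrella.kappaHat2 f)
      (fun θ => WhitneyUmbrella.FkappaHat2 a θ / WhitneyUmbrella.calA a θ) 2 ∧
    WhitneyUmbrella.IsFirstTerm (WhitneyUmbrella.kappaHat2 f) (WhitneyUmbrella.FkappaHat2 a) ∧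
    WhitneyUmbrella.HasLeadingTerm (WhitneyUmbrella.beta f)
      (fun θ => Real.cos θ * (a 0 2 * Real.cos θ ^ 2 + (2 * a 0 2 + a 2 0) * Real.sin θ ^ 2)
        * WhitneyUmbrella.calA a θ ^ 3 / a 0 2 ^ 2) 2 ∧
    (∃ Fβ : ℝ → ℝ, WhitneyUmbrella.IsFirstTerm (WhitneyUmbrella.beta f) Fβ) ∧
    ∀ Fβ : ℝ → ℝ, WhitneyUmbrella.IsFirstTerm (WhitneyUmbrella.beta f) Fβ →
      ∀ θ : ℝ, WhitneyUmbrella.FkappaHat2 a θ = 0 ↔ Fβ θ = 0 :=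
  mainTheorem5_general a f (contDiffAt_infty.1 hf.contDiffAt 3)
    (hf.isBigO_sub_whitneyJet (by lia)) hf.a02_pos.ne'
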